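/- For $n\ge 1$ let $K_n=(S^1)^n/\big((z_1,\dots,z_{n-1},z_n)\sim(\bar z_1,\dots,\bar z_{n-1},-z_n)\big)$ be the $n$-dimensional Klein bottle, with the smooth structure for which the quotient map $(S^1)^n\to K_n$ is a local diffeomorphism. The span of $K_n$, i.e. the maximal number of everywhere linearly independent vector fields on $K_n$, is $n$ if $n$ is odd and $n-1$ if $n$ is even; this holds for vector fields of class $C^r$ for every $r\in\{0,1,2,\dots,\infty\}$. For every $n\ge1$ there is a smooth ($C^\infty$) immersion $K_n\to\mathbb R^{n+1}$. -/

import Mathlib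

open scoped Manifold ContDiff

noncomputable section

namespace NKlein

/-- The involution `(z₁, …, zₙ₋₁, zₙ) ↦ (z̄₁, …, z̄ₙ₋₁, -zₙ)` of the torus `(S¹)ⁿ`.
The inverse of an element of the unit circle is its complex conjugate. -/
def invol {n : ℕ} (z : Fin n → Circle) : Fin n → Circle :=
  fun i => if (i : ℕ) + 1 = n then -z i else (z i)⁻¹

theorem invol_invol {n : ℕ} (z : Fin n → Circle) : invol (invol z) = z := by
  funext i
  by_cases h : (i : ℕ) + 1 = n <;> simp [invol, h]

theorem continuous_invol {n : ℕ} : Continuous (invol (n := n)) := by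
  refine continuous_pi fun i => ?_
  by_cases h : (i : ℕ) + 1 = n
  · simp only [invol, h, if_true]
    exact (continuous_apply i).neg
  · simp only [invol, h, if_false]
    exact (continuous_apply i).inv

/-- The equivalence relation on `(S¹)ⁿ` that identifies each point with its image under the
involution. -/
def torusSetoid (n : ℕ) : Setoid (Fin n → Circle) where
  r z w := w = z ∨ w = invol z
  iseqv :=
    { refl := fun _ => Or.inl rfl
      symm := by
        rintro z w (h | h)
        · exact Or.inl h.symm
        · exact Or.inr (by rw [h, invol_invol])
      trans := by
        rintro x y z (rfl | rfl) (rfl | rfl)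
        · exact Or.inl rfl
        · exact Or.inr rfl
        · exact Or.inr rfl
        · exact Or.inl (invol_invol _) }

end NKlein

open NKlein

/-- The `n`-dimensional Klein bottle
`Kₙ = (S¹)ⁿ / (z₁, …, zₙ₋₁, zₙ) ∼ (z̄₁, …, z̄ₙ₋₁, -zₙ)`. -/
def KleinBottle (n : ℕ) : Type :=
  Quotient (torusSetoid n)

namespace KleinBottle

/-- The quotient topology. -/
instance (n : ℕ) : TopologicalSpace (KleinBottle n) :=
  inferInstanceAs (TopologicalSpace (Quotient (torusSetoid n)))

/-- The quotient map `(S¹)ⁿ → Kₙ`. -/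
def mk {n : ℕ} (z : Fin n → Circle) : KleinBottle n :=
  Quotient.mk (torusSetoid n) z

/-- The map `ℝⁿ → Kₙ`, `(t₁, …, tₙ) ↦ [(e^{it₁}, …, e^{itₙ})]`. -/
def cover {n : ℕ} (t : EuclideanSpace ℝ (Fin n)) : KleinBottle n :=
  mk fun i => Circle.exp (t i)

theorem mk_eq_mk {n : ℕ} {z w : Fin n → Circle} :
    mk z = mk w ↔ w = z ∨ w = invol z :=
  ⟨fun h => Quotient.exact h, fun h => Quotient.sound h⟩

theorem continuous_mk {n : ℕ} : Continuous (mk (n := n)) :=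
  continuous_quotient_mk'

theorem isOpenMap_mk {n : ℕ} : IsOpenMap (mk (n := n)) := by
  intro U hU
  have hq : Topology.IsQuotientMap (mk (n := n)) := isQuotientMap_quotient_mk'
  rw [← hq.isOpen_preimage]
  have : mk ⁻¹' (mk '' U) = U ∪ invol ⁻¹' U := by
    ext w
    constructor
    · rintro ⟨z, hz, h⟩
      rcases mk_eq_mk.1 h with rfl | rfl
      · exact Or.inl hz
      · exact Or.inr (by simpa [invol_invol] using hz)
    · rintro (h | h)
      · exact ⟨w, h, rfl⟩
      · exact ⟨invol w, h, mk_eq_mk.2 (Or.inr (invol_invol w).symm)⟩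
  rw [this]
  exact hU.union (hU.preimage continuous_invol)

theorem continuous_cover {n : ℕ} : Continuous (cover (n := n)) := by
  refine continuous_mk.comp (continuous_pi fun i => ?_)
  exact Circle.exp.continuous.comp (by fun_prop)

theorem isOpenMap_cover {n : ℕ} : IsOpenMap (cover (n := n)) := by
  have h1 : IsOpenMap (fun (t : Fin n → ℝ) i => Circle.exp (t i)) :=
    IsOpenMap.piMap (fun _ => isLocalHomeomorph_circleExp.isOpenMap) (by simp)
  exact isOpenMap_mk.comp (h1.comp (EuclideanSpace.equiv (Fin n) ℝ).toHomeomorph.isOpenMap)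

theorem surjective_cover {n : ℕ} : Function.Surjective (cover (n := n)) := by
  intro q
  obtain ⟨z, rfl⟩ := Quotient.exists_rep q
  choose t ht using fun i => Circle.exp_surjective (z i)
  exact ⟨WithLp.toLp 2 t, congrArg mk (funext ht)⟩

/-- Two points with the same image in `Kₙ` differ by an affine map that covers the identity. -/
theorem exists_deck {n : ℕ} {x y : EuclideanSpace ℝ (Fin n)} (h : cover x = cover y) :
    ∃ g : EuclideanSpace ℝ (Fin n) → EuclideanSpace ℝ (Fin n),
      ContDiff ℝ ω g ∧ g x = y ∧ ∀ t, cover (g t) = cover t := by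
  rcases mk_eq_mk.1 h with h | h
  · refine ⟨fun t => t + (y - x), by fun_prop, by simp, fun t => ?_⟩
    refine congrArg mk (funext fun i => ?_)
    have := congrFun h i
    simp [Circle.exp_add, Circle.exp_sub, this]
  · refine ⟨fun t => WithLp.toLp 2 fun i =>
      if (i : ℕ) + 1 = n then t i + (y i - x i) else -t i + (y i + x i), ?_, ?_, fun t => ?_⟩
    · rw [contDiff_euclidean]
      intro i
      by_cases hi : (i : ℕ) + 1 = n <;> simp only [hi, if_true, if_false] <;> fun_prop
    · ext i
      by_cases hi : (i : ℕ) + 1 = n <;> simp [hi]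
    · refine (mk_eq_mk.2 (Or.inr ?_)).symm
      funext i
      have := congrFun h i
      by_cases hi : (i : ℕ) + 1 = n
      · simp only [invol, hi, if_true] at this ⊢
        simp [Circle.exp_add, Circle.exp_sub, this, neg_div]
      · simp only [invol, hi, if_false] at this ⊢
        simp [Circle.exp_add, this]

theorem eq_of_exp_eq {a b : ℝ} (h : Circle.exp a = Circle.exp b) (hab : |a - b| < Real.pi) :
    a = b := by
  obtain ⟨m, hm⟩ := Circle.exp_eq_exp.1 h
  have hpi := Real.pi_pos
  rw [abs_lt] at hab
  have h1 : (m : ℝ) < 1 := by nlinarith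
  have h2 : (-1 : ℝ) < m := by nlinarith
  have : m = 0 := by
    have h1' : m < 1 := by exact_mod_cast h1
    have h2' : -1 < m := by exact_mod_cast h2
    omega
  simpa [this] using hm

theorem exp_ne_neg_exp {a b : ℝ} (hab : |a - b| < Real.pi) :
    Circle.exp b ≠ -Circle.exp a := by
  intro h
  have h' : Circle.exp b = Circle.exp (a + Real.pi) := by
    rw [h]
    ext
    simp [Circle.exp_add]
  obtain ⟨m, hm⟩ := Circle.exp_eq_exp.1 h'
  have hpi := Real.pi_pos
  rw [abs_lt] at hab
  have h1 : (m : ℝ) < 0 := by nlinarith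
  have h2 : (-1 : ℝ) < m := by nlinarith
  have h1' : m < 0 := by exact_mod_cast h1
  have h2' : -1 < m := by exact_mod_cast h2
  omega

theorem isLocalHomeomorph_cover {n : ℕ} : IsLocalHomeomorph (cover (n := n)) := by
  rw [isLocalHomeomorph_iff_isOpenEmbedding_restrict]
  intro x
  refine ⟨Metric.ball x (Real.pi / 2), Metric.ball_mem_nhds _ (by positivity), ?_⟩
  refine Topology.IsOpenEmbedding.of_continuous_injective_isOpenMap
    (continuous_cover.comp continuous_subtype_val) ?_
    (isOpenMap_cover.comp Metric.isOpen_ball.isOpenMap_subtype_val)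
  rintro ⟨a, ha⟩ ⟨b, hb⟩ h
  have hab : ∀ i, |a i - b i| < Real.pi := by
    intro i
    have h1 : ‖(a - b) i‖ ≤ ‖a - b‖ := PiLp.norm_apply_le _ i
    have h2 : dist a b < Real.pi := by
      have := dist_triangle_right a b x
      rw [Metric.mem_ball] at ha hb
      linarith
    rw [dist_eq_norm] at h2
    simpa using h1.trans_lt h2
  refine Subtype.ext (PiLp.ext fun i => ?_)
  rcases mk_eq_mk.1 (show mk _ = mk _ from h) with h | h
  · exact eq_of_exp_eq (congrFun h i).symm (hab i)
  · exfalso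
    have hn : n - 1 < n := by have := i.2; omega
    have := congrFun h ⟨n - 1, hn⟩
    rw [invol, if_pos (by simp only; omega)] at this
    exact exp_ne_neg_exp (hab _) this

/-- The charts of `Kₙ` are local inverses of the covering map `ℝⁿ → Kₙ`. -/
instance (n : ℕ) : ChartedSpace (EuclideanSpace ℝ (Fin n)) (KleinBottle n) :=
  isLocalHomeomorph_cover.chartedSpace surjective_cover

theorem symm_of_mem_atlas {n : ℕ}
    {e : OpenPartialHomeomorph (KleinBottle n) (EuclideanSpace ℝ (Fin n))}
    (he : e ∈ atlas (EuclideanSpace ℝ (Fin n)) (KleinBottle n)) :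
    ∀ t, e.symm t = cover t := by
  obtain ⟨q, rfl⟩ := he
  intro t
  simp [chartAt_self_eq]

/-- The smooth (indeed real analytic) structure of `Kₙ`, for which `ℝⁿ → Kₙ`, hence also
`(S¹)ⁿ → Kₙ`, is a local diffeomorphism. -/
instance (n : ℕ) : IsManifold (𝓡 n) ω (KleinBottle n) := by
  refine isManifold_of_contDiffOn _ _ _ fun e e' he he' => ?_
  simp only [modelWithCornersSelf_coe, modelWithCornersSelf_coe_symm, Function.id_comp,
    Function.comp_id, Set.range_id, Set.inter_univ, Set.preimage_id]
  intro x hx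
  have hx' := hx
  rw [OpenPartialHomeomorph.trans_source] at hx'
  have hxs : e.symm x ∈ e'.source := hx'.2
  have hc : cover x = cover (e' (e.symm x)) := by
    have h := symm_of_mem_atlas he' (e' (e.symm x))
    rw [e'.left_inv hxs, symm_of_mem_atlas he] at h
    rwa [symm_of_mem_atlas he]
  obtain ⟨g, hg, hgx, hgc⟩ := exists_deck hc
  have hmem : ∀ᶠ t in nhds x, g t ∈ e'.target := by
    refine hg.continuous.continuousAt.eventually_mem (e'.open_target.mem_nhds ?_)
    rw [hgx]
    exact e'.map_source hxs
  have heq : (e.symm.trans e' : EuclideanSpace ℝ (Fin n) → EuclideanSpace ℝ (Fin n))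
      =ᶠ[nhds x] g := by
    filter_upwards [hmem] with t ht
    rw [OpenPartialHomeomorph.coe_trans, Function.comp_apply, symm_of_mem_atlas he, ← hgc t,
      ← symm_of_mem_atlas he', e'.right_inv ht]
  exact (hg.contDiffAt.congr_of_eventuallyEq heq).contDiffWithinAt

end KleinBottle

/-- The manifold `M` carries `k` vector fields of class `C^r` that are linearly independent at
every point. -/
def HasIndependentVectorFields (r : ℕ∞) (n : ℕ) (M : Type) [TopologicalSpace M]
    [ChartedSpace (EuclideanSpace ℝ (Fin n)) M] [IsManifold (𝓡 n) ∞ M] (k : ℕ) : Prop :=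
  ∃ V : Fin k → (x : M) → TangentSpace (𝓡 n) x,
    (∀ i, ContMDiff (𝓡 n) (𝓡 n).tangent r
      (fun x => (⟨x, V i x⟩ : TangentBundle (𝓡 n) M))) ∧
    ∀ x, LinearIndependent ℝ (fun i => V i x)

/-- `s` is the span of `M`: the maximal number of everywhere linearly independent vector fields,
computed with fields of class `C^r`. -/
def IsManifoldSpan (r : ℕ∞) (n : ℕ) (M : Type) [TopologicalSpace M]
    [ChartedSpace (EuclideanSpace ℝ (Fin n)) M] [IsManifold (𝓡 n) ∞ M] (s : ℕ) : Prop :=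
  IsGreatest {k : ℕ | HasIndependentVectorFields r n M k} s

end

noncomputable section

open Set Filter Topology

/-! Everything is lifted along `cover` to `ℝⁿ`. The deck transformations are the translations by
`2πℤⁿ` and the maps `t ↦ R t + c`, where `R` negates all coordinates but the last and `c` is `π` mod
`2π` in the last coordinate and `0` mod `2π` elsewhere. Fields on `Kₙ` are equivariant fields on
`ℝⁿ`, and maps on `Kₙ` are invariant maps. Write `n = m + 1` and `θ` for the last coordinate.

Upper bound: for even `n`, `det R = -1`, so the determinant of an equivariant `n`-frame changes sign
and vanishes somewhere (`not_exists_equivariant_frame`). Lower bound: group the first `m`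
coordinates in pairs and rotate each pair by `θ`. Since `θ ↦ θ + π` turns the rotation into its
negative, the rotated basis vectors are equivariant (`frame_reflection_add_const`). For odd `m` one
coordinate stays unpaired and costs one field.

Immersion: put `ρ_{k+1} = e^{ρ_k} cos t_k` and `y_k = e^{ρ_k} sin t_k` for the paired `k`, and close
with `e^ρ (sin 2θ, cos 2θ)` for the last radius. The `y_k` are odd under `R`, and rotating the pairs
by `θ` makes them invariant. For odd `m` the unpaired coordinate `b` enters through the figure eight
`(sin 2b, sin b)` rotated by `θ`, whose first component is `ρ_0`. Injectivity of the derivative is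
proved by peeling off polar coordinates from the last radius down to `ρ_0`
(`eq_zero_of_fderiv_coverImmersion`). -/

/-! ### Inverse function theorem and a criterion for immersions -/

theorem OpenPartialHomeomorph.mem_maximalAtlas_of_contDiffOn {E : Type*} [NormedAddCommGroup E]
    [NormedSpace ℝ E] {r : ℕ∞ω} (e : OpenPartialHomeomorph E E) (h : ContDiffOn ℝ r e e.source)
    (h' : ContDiffOn ℝ r e.symm e.target) : e ∈ IsManifold.maximalAtlas 𝓘(ℝ, E) r E := by
  refine StructureGroupoid.mem_maximalAtlas_of_mem_groupoid _ ?_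
  rw [contDiffGroupoid, mem_groupoid_of_pregroupoid]
  simpa [contDiffPregroupoid] using ⟨h, h'⟩

/-- Inverse function theorem in the form of an open partial homeomorphism that is of class `C^r`
in both directions on all of its domain. -/
theorem ContDiff.exists_openPartialHomeomorph {E : Type*} [NormedAddCommGroup E]
    [NormedSpace ℝ E] [CompleteSpace E] {r : ℕ∞ω} (hr : r ≠ 0) {f : E → E} (hf : ContDiff ℝ r f)
    {f' : E ≃L[ℝ] E} {x : E} (hx : HasFDerivAt f (f' : E →L[ℝ] E) x) :
    ∃ e : OpenPartialHomeomorph E E, (∀ y, e y = f y) ∧ x ∈ e.source ∧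
      ContDiffOn ℝ r e.symm e.target := by
  -- Restricting the local inverse to this open set makes the derivative invertible at every point
  -- of the source, so the inverse is `C^r` on the whole target.
  have hopen : IsOpen {y | ∃ g : E ≃L[ℝ] E, (g : E →L[ℝ] E) = fderiv ℝ f y} := by
    have := (ContinuousLinearEquiv.isOpen (𝕜 := ℝ) (E := E) (F := E)).preimage
      (hf.continuous_fderiv hr)
    exact this
  let e₀ := hf.contDiffAt.toOpenPartialHomeomorph f hx hr
  refine ⟨e₀.restrOpen _ hopen, fun y => rfl, ?_, ?_⟩
  · rw [OpenPartialHomeomorph.restrOpen_source]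
    exact ⟨hf.contDiffAt.mem_toOpenPartialHomeomorph_source hx hr, f', hx.fderiv.symm⟩
  · intro y hy
    have hmem := (e₀.restrOpen _ hopen).map_target hy
    rw [OpenPartialHomeomorph.restrOpen_source] at hmem
    obtain ⟨-, g, hg⟩ := hmem
    refine (OpenPartialHomeomorph.contDiffAt_symm (f₀' := g) _ hy ?_
      hf.contDiffAt).contDiffWithinAt
    rw [hg]
    exact (hf.differentiable hr _).hasFDerivAt

/-- A map that in some chart is a smooth map with injective derivative is an immersion. -/
theorem Manifold.IsImmersionAtOfComplement.of_injective_fderiv {E F M : Type*} [NormedAddCommGroup E]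
    [NormedSpace ℝ E] [FiniteDimensional ℝ E] [NormedAddCommGroup F] [NormedSpace ℝ F]
    [FiniteDimensional ℝ F] [TopologicalSpace M] [ChartedSpace E M] {r : ℕ∞ω} (hr : r ≠ 0)
    [IsManifold 𝓘(ℝ, E) r M]
    {f : M → F} {x : M} {e : OpenPartialHomeomorph M E} (he : e ∈ atlas E M) (hx : x ∈ e.source)
    {φ : E → F} (hφ : ContDiff ℝ r φ) (hfφ : ∀ u, f (e.symm u) = φ u)
    (hinj : Function.Injective (fderiv ℝ φ (e x))) (C : Type*) [NormedAddCommGroup C]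
    [NormedSpace ℝ C] [FiniteDimensional ℝ C]
    (hC : Module.finrank ℝ E + Module.finrank ℝ C = Module.finrank ℝ F) :
    Manifold.IsImmersionAtOfComplement C 𝓘(ℝ, E) 𝓘(ℝ, F) r f x := by
  have : CompleteSpace E := FiniteDimensional.complete ℝ E
  have : CompleteSpace F := FiniteDimensional.complete ℝ F
  obtain ⟨G, hG⟩ := Submodule.exists_isCompl (fderiv ℝ φ (e x)).range
  have hker : (fderiv ℝ φ (e x)).ker = ⊥ := LinearMap.ker_eq_bot.2 hinj
  have : CompleteSpace G := FiniteDimensional.complete ℝ G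
  let L : (E × G) ≃L[ℝ] F := (fderiv ℝ φ (e x)).coprodSubtypeLEquivOfIsCompl hG hker
  have hL : (L : E × G →L[ℝ] F) = (fderiv ℝ φ (e x)).coprod G.subtypeL := rfl
  -- `φ` is thickened by a complement `G` of the image of its derivative; `Φ` is then a local
  -- diffeomorphism with derivative `L` at `(e x, 0)`.
  let Φ : E × G → F := fun q => φ q.1 + q.2
  have hΦ : ContDiff ℝ r Φ := by
    have h2 : ContDiff ℝ r fun q : E × G => G.subtypeL q.2 :=
      G.subtypeL.contDiff.comp contDiff_snd
    exact (hφ.comp contDiff_fst).add h2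
  have hΦ' : HasFDerivAt Φ (L : E × G →L[ℝ] F) (e x, 0) := by
    rw [hL]
    have h1 : HasFDerivAt (fun q : E × G => φ q.1)
        ((fderiv ℝ φ (e x)).comp (ContinuousLinearMap.fst ℝ E G)) (e x, 0) :=
      ((hφ.differentiable hr _).hasFDerivAt).comp (e x, (0 : G)) hasFDerivAt_fst
    have h2 : HasFDerivAt (fun q : E × G => G.subtypeL q.2)
        (G.subtypeL.comp (ContinuousLinearMap.snd ℝ E G)) (e x, 0) :=
      G.subtypeL.hasFDerivAt.comp (e x, (0 : G)) hasFDerivAt_snd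
    refine (h1.add h2).congr_fderiv ?_
    ext <;> simp
  -- Precomposing with `L.symm` gives a self-map of `F` with derivative the identity; its local
  -- inverse is the chart of `F` in which `f` becomes `u ↦ (u, 0)`.
  let Ψ : F → F := Φ ∘ L.symm
  have hΨ : ContDiff ℝ r Ψ := hΦ.comp L.symm.contDiff
  have hΨ' : HasFDerivAt Ψ ((ContinuousLinearEquiv.refl ℝ F : F ≃L[ℝ] F) : F →L[ℝ] F)
      (L (e x, 0)) := by
    have h1 : HasFDerivAt Φ (L : E × G →L[ℝ] F) (L.symm (L (e x, 0))) := by simpa using hΦ'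
    refine (h1.comp (L (e x, 0)) L.symm.hasFDerivAt).congr_fderiv ?_
    ext y
    simp
  obtain ⟨ψ, hψ, hmem, hψs⟩ := hΨ.exists_openPartialHomeomorph hr hΨ'
  have hψφ : ∀ u, ψ (L (u, 0)) = φ u := fun u => by simp [hψ, Ψ, Φ]
  have hS : IsOpen ((fun u : E => L (u, 0)) ⁻¹' ψ.source) :=
    ψ.open_source.preimage (by fun_prop)
  have hfx : f x = φ (e x) := by rw [← hfφ, e.left_inv hx]
  have hT : IsOpen (e.source ∩ e ⁻¹' ((fun u : E => L (u, 0)) ⁻¹' ψ.source)) :=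
    e.isOpen_inter_preimage hS
  -- The chart is shrunk so that `L (u, 0)` stays where `ψ` is invertible.
  let d := e.restr (e.source ∩ e ⁻¹' ((fun u : E => L (u, 0)) ⁻¹' ψ.source))
  have hds : d.source = e.source ∩ (e.source ∩ e ⁻¹' ((fun u : E => L (u, 0)) ⁻¹' ψ.source)) :=
    e.restr_source' _ hT
  have hdt : ∀ u ∈ d.target, L (u, 0) ∈ ψ.source := fun u hu => by
    have h1 := d.map_target hu
    rw [hds] at h1
    have h2 : L (e (d.symm u), 0) ∈ ψ.source := h1.2.2
    have h3 : e (d.symm u) = u := d.right_inv hu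
    rwa [h3] at h2
  have hGC : Module.finrank ℝ G = Module.finrank ℝ C := by
    have h1 := Submodule.finrank_add_eq_of_isCompl hG
    have h2 := LinearMap.finrank_range_of_inj (f := (fderiv ℝ φ (e x)).toLinearMap) hinj
    omega
  refine Manifold.IsImmersionAtOfComplement.trans_F (F := G) ?_
    (ContinuousLinearEquiv.ofFinrankEq hGC)
  refine Manifold.IsImmersionAtOfComplement.mk_of_continuousAt ?_ L d ψ.symm ?_ ?_ ?_ ?_ ?_
  · have : f =ᶠ[𝓝 x] fun y => φ (e y) := by
      filter_upwards [e.open_source.mem_nhds hx] with y hy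
      rw [← hfφ, e.left_inv hy]
    exact (hφ.continuous.continuousAt.comp (e.continuousAt hx)).congr this.symm
  · rw [hds]
    exact ⟨hx, hx, hmem⟩
  · rw [hfx, ← hψφ]
    exact ψ.map_source hmem
  · exact restr_mem_maximalAtlas _ (IsManifold.subset_maximalAtlas he) hT
  · refine ψ.symm.mem_maximalAtlas_of_contDiffOn hψs ?_
    exact hΨ.contDiffOn.congr fun y _ => hψ y
  · intro u hu
    have hu' : u ∈ d.target := by simpa using hu
    have : f (d.symm u) = φ u := hfφ u
    simp [this]
    rw [← hψφ, ψ.left_inv (hdt u hu')]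

/-! ### Deck transformations and the derivative of the covering -/

namespace KleinBottle

open NKlein

variable {n m : ℕ}

/-- The reflection `(t₁, …, tₙ₋₁, tₙ) ↦ (-t₁, …, -tₙ₋₁, tₙ)`. -/
def reflection (n : ℕ) : EuclideanSpace ℝ (Fin n) →L[ℝ] EuclideanSpace ℝ (Fin n) :=
  LinearMap.toContinuousLinearMap
    { toFun := fun t => WithLp.toLp 2 fun i => if (i : ℕ) + 1 = n then t i else -t i
      map_add' := fun t u => by
        ext i
        by_cases h : (i : ℕ) + 1 = n <;> simp [h, add_comm]
      map_smul' := fun a t => by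
        ext i
        by_cases h : (i : ℕ) + 1 = n <;> simp [h] }

@[simp]
theorem reflection_apply (t : EuclideanSpace ℝ (Fin n)) (i : Fin n) :
    reflection n t i = if (i : ℕ) + 1 = n then t i else -t i := rfl

theorem reflection_reflection (t : EuclideanSpace ℝ (Fin n)) :
    reflection n (reflection n t) = t := by
  ext i
  by_cases h : (i : ℕ) + 1 = n <;> simp [h]

theorem cover_eq_cover {x y : EuclideanSpace ℝ (Fin n)} :
    cover x = cover y ↔ (∀ i, Circle.exp (y i) = Circle.exp (x i)) ∨
      ∀ i : Fin n, Circle.exp (y i) =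
        if (i : ℕ) + 1 = n then -Circle.exp (x i) else (Circle.exp (x i))⁻¹ := by
  rw [cover, cover, mk_eq_mk, funext_iff, funext_iff]
  rfl

theorem cover_add_const {c : EuclideanSpace ℝ (Fin n)} (hc : ∀ i, Circle.exp (c i) = 1)
    (t : EuclideanSpace ℝ (Fin n)) : cover (t + c) = cover t :=
  cover_eq_cover.2 (Or.inl fun i => by simp [Circle.exp_add, hc])

theorem cover_reflection_add_const {c : EuclideanSpace ℝ (Fin n)}
    (hc : ∀ i : Fin n, Circle.exp (c i) = if (i : ℕ) + 1 = n then -1 else 1)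
    (t : EuclideanSpace ℝ (Fin n)) : cover (reflection n t + c) = cover t := by
  refine (cover_eq_cover.2 (Or.inr fun i => ?_)).symm
  by_cases h : (i : ℕ) + 1 = n <;> simp [Circle.exp_add, hc, h]

/-- Points with the same image in `Kₙ` are related by a deck transformation. -/
theorem exists_deck_of_cover_eq {x y : EuclideanSpace ℝ (Fin n)} (h : cover x = cover y) :
    (∃ c : EuclideanSpace ℝ (Fin n), (∀ i, Circle.exp (c i) = 1) ∧ y = x + c) ∨
      ∃ c : EuclideanSpace ℝ (Fin n),
        (∀ i : Fin n, Circle.exp (c i) = if (i : ℕ) + 1 = n then -1 else 1) ∧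
          y = reflection n x + c := by
  rcases cover_eq_cover.1 h with h | h
  · refine Or.inl ⟨y - x, fun i => ?_, by simp⟩
    simp [Circle.exp_sub, h i]
  · refine Or.inr ⟨y - reflection n x, fun i => ?_, by simp⟩
    by_cases hi : (i : ℕ) + 1 = n <;> simp [Circle.exp_sub, h i, hi, neg_div]

theorem exists_affine_deck {x y : EuclideanSpace ℝ (Fin n)} (h : cover x = cover y) :
    ∃ (A : EuclideanSpace ℝ (Fin n) →L[ℝ] EuclideanSpace ℝ (Fin n))
      (c : EuclideanSpace ℝ (Fin n)), Function.Bijective A ∧ A x + c = y ∧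
        ∀ t, cover (A t + c) = cover t := by
  rcases exists_deck_of_cover_eq h with ⟨c, hc, rfl⟩ | ⟨c, hc, rfl⟩
  · exact ⟨ContinuousLinearMap.id ℝ _, c, Function.bijective_id, rfl, cover_add_const hc⟩
  · exact ⟨reflection n, c, Function.Involutive.bijective reflection_reflection, rfl,
      cover_reflection_add_const hc⟩

theorem cover_chartAt (t : EuclideanSpace ℝ (Fin n)) :
    cover (chartAt (EuclideanSpace ℝ (Fin n)) (cover t) (cover t)) = cover t := by
  rw [← symm_of_mem_atlas (chart_mem_atlas _ (cover t)),
    (chartAt _ (cover t)).left_inv (mem_chart_source _ _)]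

/-- Inverse charts are restrictions of `cover`, which settles the points that the preferred charts
hit. A deck transformation moves any `t` to such a point. -/
theorem contMDiff_cover : ContMDiff (𝓡 n) (𝓡 n) ω (cover (n := n)) := by
  intro t
  obtain ⟨A, c, -, hA, hc⟩ := exists_affine_deck (cover_chartAt t).symm
  have h1 : ContMDiffAt (𝓡 n) (𝓡 n) ω (cover (n := n)) (A t + c) := by
    have h := contMDiffOn_chart_symm (I := 𝓡 n) (n := ω) (x := cover t)
    have h2 := h.contMDiffAt ((chartAt _ _).open_target.mem_nhds (mem_chart_target _ (cover t)))
    rw [hA]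
    exact h2.congr_of_eventuallyEq
      (Eventually.of_forall fun u => (symm_of_mem_atlas (chart_mem_atlas _ _) u).symm)
  have h2 : ContMDiffAt (𝓡 n) (𝓡 n) ω (fun u => A u + c) t :=
    (A.contDiff.add contDiff_const).contMDiff.contMDiffAt
  have h3 := ContMDiffAt.comp (g := cover) t h1 h2
  have h4 : cover ∘ (fun u => A u + c) = cover (n := n) := funext hc
  rwa [h4] at h3

theorem mdifferentiableAt_cover (t : EuclideanSpace ℝ (Fin n)) :
    MDifferentiableAt (𝓡 n) (𝓡 n) cover t :=
  contMDiff_cover.mdifferentiableAt (by simp)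

/-- Chain rule for `cover ∘ g = cover` with `g` affine. -/
theorem mfderiv_cover_deck {A : EuclideanSpace ℝ (Fin n) →L[ℝ] EuclideanSpace ℝ (Fin n)}
    {c : EuclideanSpace ℝ (Fin n)} (hc : ∀ t, cover (A t + c) = cover t)
    (t v : EuclideanSpace ℝ (Fin n)) :
    (mfderiv (𝓡 n) (𝓡 n) cover t v : EuclideanSpace ℝ (Fin n)) =
      mfderiv (𝓡 n) (𝓡 n) cover (A t + c) (A v) := by
  have h2 : HasMFDerivAt (𝓡 n) (𝓡 n) (fun u => A u + c) t A :=
    (A.hasFDerivAt.add_const c).hasMFDerivAt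
  have h3 := (mdifferentiableAt_cover (A t + c)).hasMFDerivAt.comp t h2
  have h4 : cover ∘ (fun u => A u + c) = cover (n := n) := funext hc
  rw [h4] at h3
  have h5 := h3.mfderiv
  exact congrArg (fun L : EuclideanSpace ℝ (Fin n) →L[ℝ] EuclideanSpace ℝ (Fin n) => L v) h5

theorem bijective_mfderiv_cover (t : EuclideanSpace ℝ (Fin n)) :
    Function.Bijective (mfderiv (𝓡 n) (𝓡 n) cover t) := by
  obtain ⟨A, c, hAb, hA, hc⟩ := exists_affine_deck (cover_chartAt t).symm
  have h1 : Function.Bijective (mfderiv (𝓡 n) (𝓡 n) cover (A t + c)) := by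
    have h := (mdifferentiable_chart (I := 𝓡 n) (cover t)).symm.mfderiv_bijective
      (mem_chart_target _ (cover t))
    rw [hA]
    have : ((chartAt (EuclideanSpace ℝ (Fin n)) (cover t)).symm) = (cover : _ → KleinBottle n) :=
      funext fun u => symm_of_mem_atlas (chart_mem_atlas _ _) u
    rwa [this] at h
  have h2 := h1.comp hAb
  have h3 : (fun v : EuclideanSpace ℝ (Fin n) =>
      (mfderiv (𝓡 n) (𝓡 n) cover t v : EuclideanSpace ℝ (Fin n))) =
      fun v => mfderiv (𝓡 n) (𝓡 n) cover (A t + c) (A v) :=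
    funext fun v => mfderiv_cover_deck hc t v
  have h4 : Function.Bijective (fun v : EuclideanSpace ℝ (Fin n) =>
      (mfderiv (𝓡 n) (𝓡 n) cover t v : EuclideanSpace ℝ (Fin n))) := by
    rw [h3]
    exact h2
  exact h4

theorem isInvertible_mfderiv_cover (t : EuclideanSpace ℝ (Fin n)) :
    (mfderiv (𝓡 n) (𝓡 n) cover t).IsInvertible := by
  let L : EuclideanSpace ℝ (Fin n) →L[ℝ] EuclideanSpace ℝ (Fin n) :=
    mfderiv (𝓡 n) (𝓡 n) cover t
  have hL : Function.Bijective L := bijective_mfderiv_cover t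
  exact ⟨(LinearEquiv.ofBijective L.toLinearMap hL).toContinuousLinearEquiv, rfl⟩

/-! ### Upper bounds for the span -/

/-- The reflection is diagonal with `n - 1` entries `-1`, an odd number. -/
theorem det_reflection (hn : 1 ≤ n) (he : Even n) (w : Fin n → EuclideanSpace ℝ (Fin n)) :
    (Matrix.of fun i => (reflection n (w i)).ofLp).det = -(Matrix.of fun i => (w i).ofLp).det := by
  have h1 : (Matrix.of fun i => (reflection n (w i)).ofLp) = (Matrix.of fun i => (w i).ofLp) *
      Matrix.diagonal fun j : Fin n => if (j : ℕ) + 1 = n then (1 : ℝ) else -1 := by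
    ext i j
    rw [Matrix.mul_diagonal]
    by_cases h : (j : ℕ) + 1 = n <;> simp [h]
  obtain ⟨m, rfl⟩ : ∃ m, n = m + 1 := ⟨n - 1, by omega⟩
  have h2 : (∏ j : Fin (m + 1), if (j : ℕ) + 1 = m + 1 then (1 : ℝ) else -1) = -1 := by
    rw [Fin.prod_univ_castSucc]
    have h3 : ∀ j : Fin m, (j : ℕ) ≠ m := fun j => j.2.ne
    have h4 : Odd m := by
      rcases Nat.even_or_odd m with h | h
      · exact absurd he (by simp [Nat.even_add_one, h])
      · exact h
    simp [h3, h4.neg_one_pow]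
  rw [h1, Matrix.det_mul, Matrix.det_diagonal, h2]
  ring

/-- The determinant of the frame is continuous and takes opposite values at `0` and at its image, so
by the intermediate value theorem it has a zero. -/
theorem not_exists_equivariant_frame (hn : 1 ≤ n) (he : Even n)
    {w : Fin n → EuclideanSpace ℝ (Fin n) → EuclideanSpace ℝ (Fin n)}
    (hw : ∀ i, Continuous (w i)) {c : EuclideanSpace ℝ (Fin n)}
    (hc : ∀ i t, w i (reflection n t + c) = reflection n (w i t)) :
    ¬ ∀ t, LinearIndependent ℝ fun i => w i t := by
  intro hli
  let D : EuclideanSpace ℝ (Fin n) → ℝ := fun t => (Matrix.of fun i => (w i t).ofLp).det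
  have hD : Continuous D := by
    refine Continuous.matrix_det (continuous_matrix fun i j => ?_)
    have := hw i
    simp only [Matrix.of_apply]
    fun_prop
  have hD0 : ∀ t, D t ≠ 0 := fun t => by
    have h1 : LinearIndependent ℝ (Matrix.of fun i => (w i t).ofLp).row :=
      (hli t).map' (WithLp.linearEquiv 2 ℝ (Fin n → ℝ)).toLinearMap
        (LinearEquiv.ker _)
    rw [Matrix.linearIndependent_rows_iff_isUnit, Matrix.isUnit_iff_isUnit_det] at h1
    exact h1.ne_zero
  have hDc : D (reflection n 0 + c) = -D 0 := by
    simp only [D, hc]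
    exact det_reflection hn he _
  obtain ⟨t, ht⟩ : (0 : ℝ) ∈ range D := by
    rcases le_total 0 (D 0) with h | h
    · exact mem_range_of_exists_le_of_exists_ge hD ⟨reflection n 0 + c, by linarith⟩ ⟨0, h⟩
    · exact mem_range_of_exists_le_of_exists_ge hD ⟨0, h⟩ ⟨reflection n 0 + c, by linarith⟩
  exact hD0 t ht

theorem mfderiv_cover_mpullback (V : (x : KleinBottle n) → TangentSpace (𝓡 n) x)
    (t : EuclideanSpace ℝ (Fin n)) :
    mfderiv (𝓡 n) (𝓡 n) cover t (VectorField.mpullback (𝓡 n) (𝓡 n) cover V t) = V (cover t) := by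
  obtain ⟨L, hL⟩ := isInvertible_mfderiv_cover t
  rw [VectorField.mpullback_apply, ← hL, ContinuousLinearMap.inverse_equiv]
  exact L.apply_symm_apply _

/-- Both sides have the same image under the injective derivative of `cover` at `A t + c`. -/
theorem mpullback_cover_deck (V : (x : KleinBottle n) → TangentSpace (𝓡 n) x)
    {A : EuclideanSpace ℝ (Fin n) →L[ℝ] EuclideanSpace ℝ (Fin n)}
    {c : EuclideanSpace ℝ (Fin n)} (hc : ∀ t, cover (A t + c) = cover t)
    (t : EuclideanSpace ℝ (Fin n)) :
    (VectorField.mpullback (𝓡 n) (𝓡 n) cover V (A t + c) : EuclideanSpace ℝ (Fin n)) =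
      A (VectorField.mpullback (𝓡 n) (𝓡 n) cover V t) := by
  refine (bijective_mfderiv_cover (A t + c)).1 ?_
  refine (mfderiv_cover_mpullback V (A t + c)).trans ?_
  refine Eq.trans ?_ (mfderiv_cover_deck hc t _)
  refine Eq.trans ?_ (mfderiv_cover_mpullback V t).symm
  exact congrArg (fun x => (V x : EuclideanSpace ℝ (Fin n))) (hc t)

theorem continuous_mpullback_cover {r : ℕ∞} {V : (x : KleinBottle n) → TangentSpace (𝓡 n) x}
    (hV : ContMDiff (𝓡 n) (𝓡 n).tangent r
      (fun x => (⟨x, V x⟩ : TangentBundle (𝓡 n) (KleinBottle n)))) :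
    Continuous (fun t => (VectorField.mpullback (𝓡 n) (𝓡 n) cover V t :
      EuclideanSpace ℝ (Fin n))) := by
  have h1 : ContMDiff (𝓡 n) (𝓡 n).tangent 0
      (fun x => (⟨x, V x⟩ : TangentBundle (𝓡 n) (KleinBottle n))) := hV.of_le (by simp)
  have h3 : ContMDiff (𝓡 n) (𝓡 n) 1 (cover (n := n)) := contMDiff_cover.of_le le_top
  have h2 := h1.mpullback_vectorField h3
    isInvertible_mfderiv_cover (by simp)
  exact (contMDiff_vectorSpace_iff_contDiff.1 h2).continuous

theorem not_hasIndependentVectorFields_of_even (hn : 1 ≤ n) (he : Even n) (r : ℕ∞) :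
    ¬ HasIndependentVectorFields r n (KleinBottle n) n := by
  rintro ⟨V, hV, hli⟩
  -- With `c = (0, …, 0, π)`, the map `t ↦ reflection n t + c` lifts the involution of the torus.
  let c : EuclideanSpace ℝ (Fin n) :=
    WithLp.toLp 2 fun i => if (i : ℕ) + 1 = n then Real.pi else 0
  have hc : ∀ t, cover (reflection n t + c) = cover t := by
    refine cover_reflection_add_const fun i => ?_
    by_cases h : (i : ℕ) + 1 = n <;> simp [c, h]
    ext
    simp
  refine not_exists_equivariant_frame hn he
    (w := fun i t => VectorField.mpullback (𝓡 n) (𝓡 n) cover (V i) t)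
    (fun i => continuous_mpullback_cover (hV i)) (fun i t => mpullback_cover_deck (V i) hc t)
    fun t => ?_
  have h1 : LinearIndependent ℝ fun i => mfderiv (𝓡 n) (𝓡 n) cover t
      (VectorField.mpullback (𝓡 n) (𝓡 n) cover (V i) t) := by
    simp only [mfderiv_cover_mpullback]
    exact hli (cover t)
  exact h1.of_comp (mfderiv (𝓡 n) (𝓡 n) cover t).toLinearMap

theorem le_of_hasIndependentVectorFields {r : ℕ∞} {k : ℕ}
    (h : HasIndependentVectorFields r n (KleinBottle n) k) : k ≤ n := by
  obtain ⟨V, -, hli⟩ := h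
  let w : Fin k → EuclideanSpace ℝ (Fin n) := fun i => V i (cover 0)
  have h1 : LinearIndependent ℝ w := hli (cover 0)
  simpa using h1.fintype_card_le_finrank

/-! ### Descent of equivariant fields and the maximal frame -/

/-- Vector fields on `ℝⁿ` that are equivariant under the deck transformations descend to `Kₙ`. -/
theorem hasIndependentVectorFields_of_equivariant (r : ℕ∞) {k : ℕ}
    {v : Fin k → EuclideanSpace ℝ (Fin n) → EuclideanSpace ℝ (Fin n)}
    (hv : ∀ i, ContDiff ℝ ∞ (v i))
    (hid : ∀ i (c : EuclideanSpace ℝ (Fin n)), (∀ j, Circle.exp (c j) = 1) →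
      ∀ t, v i (t + c) = v i t)
    (hrefl : ∀ i (c : EuclideanSpace ℝ (Fin n)),
      (∀ j : Fin n, Circle.exp (c j) = if (j : ℕ) + 1 = n then -1 else 1) →
      ∀ t, v i (reflection n t + c) = reflection n (v i t))
    (hli : ∀ t, LinearIndependent ℝ fun i => v i t) :
    HasIndependentVectorFields r n (KleinBottle n) k := by
  have key : ∀ (i : Fin k) {x y : EuclideanSpace ℝ (Fin n)}, cover x = cover y →
      (mfderiv (𝓡 n) (𝓡 n) cover x (v i x) : EuclideanSpace ℝ (Fin n)) =
        mfderiv (𝓡 n) (𝓡 n) cover y (v i y) := by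
    intro i x y h
    rcases exists_deck_of_cover_eq h with ⟨c, hc, rfl⟩ | ⟨c, hc, rfl⟩
    · rw [hid i c hc]
      exact mfderiv_cover_deck (A := ContinuousLinearMap.id ℝ _) (cover_add_const hc) x (v i x)
    · rw [hrefl i c hc]
      exact mfderiv_cover_deck (cover_reflection_add_const hc) x (v i x)
  -- The section `s` need not be continuous: by `key` the pushed-forward vector does not depend on
  -- the lift.
  let s : KleinBottle n → EuclideanSpace ℝ (Fin n) := Function.surjInv surjective_cover
  have hs : ∀ x, cover (s x) = x := Function.surjInv_eq surjective_cover
  let V : Fin k → (x : KleinBottle n) → TangentSpace (𝓡 n) x :=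
    fun i x => (mfderiv (𝓡 n) (𝓡 n) cover (s x) (v i (s x)) : EuclideanSpace ℝ (Fin n))
  refine ⟨V, fun i x => ?_, fun x => ?_⟩
  · let e := chartAt (EuclideanSpace ℝ (Fin n)) x
    have he : e.MDifferentiable (𝓡 n) (𝓡 n) := mdifferentiable_chart x
    have hec : ∀ t, e.symm t = cover t := symm_of_mem_atlas (chart_mem_atlas _ x)
    have hsymm : ⇑e.symm = cover := funext hec
    have hL : ∀ y ∈ e.source, ∃ L : EuclideanSpace ℝ (Fin n) ≃L[ℝ] EuclideanSpace ℝ (Fin n),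
        (L : EuclideanSpace ℝ (Fin n) →L[ℝ] EuclideanSpace ℝ (Fin n)) =
          mfderiv (𝓡 n) (𝓡 n) e y ∧
        (L.symm : EuclideanSpace ℝ (Fin n) →L[ℝ] EuclideanSpace ℝ (Fin n)) =
          mfderiv (𝓡 n) (𝓡 n) cover (e y) := by
      intro y hy
      have h1 := he.symm_comp_deriv hy
      have h2 := he.comp_symm_deriv (e.map_source hy)
      rw [e.left_inv hy] at h2
      rw [hsymm] at h1 h2
      exact ⟨ContinuousLinearEquiv.equivOfInverse _ _
        (fun w => DFunLike.congr_fun h1 w) (fun w => DFunLike.congr_fun h2 w), rfl, rfl⟩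
    -- Since the inverse chart is `cover`, the field `V i` is locally the pullback of `v i` along
    -- the chart, which gives its regularity.
    have hinv : ∀ y ∈ e.source, VectorField.mpullback (𝓡 n) (𝓡 n) e (v i) y = V i y := by
      intro y hy
      obtain ⟨L, hL1, hL2⟩ := hL y hy
      have h1 : (mfderiv (𝓡 n) (𝓡 n) e y).inverse = mfderiv (𝓡 n) (𝓡 n) cover (e y) := by
        rw [← hL2]
        refine Eq.trans (congrArg ContinuousLinearMap.inverse hL1.symm) ?_
        exact ContinuousLinearMap.inverse_equiv L
      refine Eq.trans (congrArg (fun L : EuclideanSpace ℝ (Fin n) →L[ℝ] EuclideanSpace ℝ (Fin n) =>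
        L (v i (e y))) h1) (key i ?_)
      rw [hs, ← hec, e.left_inv hy]
    have hvi : ContMDiff (𝓡 n) (𝓡 n).tangent r
        (fun t => (⟨t, v i t⟩ : TangentBundle (𝓡 n) (EuclideanSpace ℝ (Fin n)))) :=
      contMDiff_vectorSpace_iff_contDiff.2 ((hv i).of_le (by simp))
    have hx : x ∈ e.source := mem_chart_source _ x
    have hes : ContMDiffAt (𝓡 n) (𝓡 n) ∞ e x :=
      contMDiffAt_of_mem_maximalAtlas (IsManifold.chart_mem_maximalAtlas x) hx
    refine ContMDiffAt.congr_of_eventuallyEq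
      ((hvi (e x)).mpullback_vectorField_preimage (f := e) (n := ∞)
      (I := 𝓡 n) (I' := 𝓡 n) hes
      (let ⟨L, hL1, _⟩ := hL x hx; ⟨L, hL1⟩) ?_) ?_
    -- A pullback differentiates the chart once, so a `C^r` field requires a chart of class
    -- `C^(r+1)`.
    · exact_mod_cast (le_top : (r + 1 : ℕ∞) ≤ ⊤)
    · filter_upwards [e.open_source.mem_nhds hx] with y hy
      rw [hinv y hy]
  · have h1 : LinearIndependent ℝ fun i => v i (s x) := hli (s x)
    let L : EuclideanSpace ℝ (Fin n) →L[ℝ] EuclideanSpace ℝ (Fin n) :=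
      mfderiv (𝓡 n) (𝓡 n) cover (s x)
    exact h1.map' L.toLinearMap (LinearMap.ker_eq_bot.2 (bijective_mfderiv_cover (s x)).1)

theorem cos_sin_of_circleExp_eq_one {a : ℝ} (h : Circle.exp a = 1) :
    Real.cos a = 1 ∧ Real.sin a = 0 := by
  have h1 : Complex.exp (a * Complex.I) = 1 := by
    rw [← Circle.coe_exp, h, Circle.coe_one]
  exact ⟨by simpa using congrArg Complex.re h1, by simpa using congrArg Complex.im h1⟩

theorem cos_sin_of_circleExp_eq_neg_one {a : ℝ} (h : Circle.exp a = -1) :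
    Real.cos a = -1 ∧ Real.sin a = 0 := by
  have h1 : Complex.exp (a * Complex.I) = -1 := by
    rw [← Circle.coe_exp, h]
    simp
  exact ⟨by simpa using congrArg Complex.re h1, by simpa using congrArg Complex.im h1⟩

/-- The involution of the first `m + 1` numbers that exchanges `2j` and `2j + 1` for
`2j + 1 < m`. -/
def pairSwap (j : Fin (m + 1)) : Fin (m + 1) :=
  if h : (j : ℕ) < 2 * (m / 2) then
    if Even (j : ℕ) then ⟨j + 1, by omega⟩ else ⟨j - 1, by omega⟩
  else j

theorem pairSwap_lt_iff (j : Fin (m + 1)) :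
    (pairSwap j : ℕ) < 2 * (m / 2) ↔ (j : ℕ) < 2 * (m / 2) := by
  unfold pairSwap
  by_cases h : (j : ℕ) < 2 * (m / 2)
  · by_cases h' : Even (j : ℕ)
    · simp only [h, h', dif_pos, if_true, iff_true]
      rw [Nat.even_iff] at h'
      omega
    · simp only [h, h', dif_pos, if_false, iff_true]
      omega
  · simp [h]

theorem even_pairSwap_iff {j : Fin (m + 1)} (h : (j : ℕ) < 2 * (m / 2)) :
    Even (pairSwap j : ℕ) ↔ ¬ Even (j : ℕ) := by
  unfold pairSwap
  by_cases h' : Even (j : ℕ)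
  · simp [h, h', Nat.even_add_one]
  · simp only [h, h', dif_pos, if_false, not_false_eq_true, iff_true]
    rw [Nat.even_iff] at h' ⊢
    omega

theorem pairSwap_pairSwap (j : Fin (m + 1)) : pairSwap (pairSwap j) = j := by
  by_cases h : (j : ℕ) < 2 * (m / 2)
  · have h1 := (pairSwap_lt_iff j).2 h
    have h2 := even_pairSwap_iff h
    rw [pairSwap, dif_pos h1]
    ext
    by_cases h' : Even (j : ℕ)
    · rw [if_neg (by simpa [h2] using h')]
      simp [pairSwap, h, h']
    · rw [if_pos (by simpa [h2] using h')]
      have : (j : ℕ) ≠ 0 := fun h0 => h' (by simp [h0])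
      simp only [pairSwap, h, h', dif_pos, if_false]
      omega
  · simp [pairSwap, h]

/-- Apply `(a, b) ↦ (c * a - s * b, s * a + c * b)` to the pairs of coordinates with the indices
`2j`, `2j + 1`, where `2j + 1 < m`. -/
def pairRotation (c s : ℝ) : (Fin (m + 1) → ℝ) →ₗ[ℝ] Fin (m + 1) → ℝ where
  toFun y j := if (j : ℕ) < 2 * (m / 2) then
    c * y j + (if Even (j : ℕ) then -s else s) * y (pairSwap j) else y j
  map_add' y z := by
    ext j
    by_cases h : (j : ℕ) < 2 * (m / 2)
    · simp only [h, if_true, Pi.add_apply]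
      ring
    · simp [h]
  map_smul' a y := by
    ext j
    by_cases h : (j : ℕ) < 2 * (m / 2)
    · simp only [h, if_true, Pi.smul_apply, smul_eq_mul, RingHom.id_apply]
      ring
    · simp [h]

theorem pairRotation_apply (c s : ℝ) (y : Fin (m + 1) → ℝ) (j : Fin (m + 1)) :
    pairRotation c s y j = if (j : ℕ) < 2 * (m / 2) then
      c * y j + (if Even (j : ℕ) then -s else s) * y (pairSwap j) else y j := rfl

theorem pairRotation_neg_pairRotation {c s : ℝ} (h : c ^ 2 + s ^ 2 = 1) (y : Fin (m + 1) → ℝ) :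
    pairRotation c (-s) (pairRotation c s y) = y := by
  ext j
  by_cases hj : (j : ℕ) < 2 * (m / 2)
  · have h1 := (pairSwap_lt_iff j).2 hj
    have h2 := even_pairSwap_iff hj
    rw [pairRotation_apply, pairRotation_apply, pairRotation_apply, if_pos hj, if_pos hj,
      if_pos h1, pairSwap_pairSwap]
    by_cases h' : Even (j : ℕ)
    · rw [if_neg (fun h3 => h2.1 h3 h'), if_pos h', if_pos h']
      linear_combination y j * h
    · rw [if_pos (h2.2 h'), if_neg h', if_neg h']
      linear_combination y j * h
  · simp [pairRotation_apply, hj]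

theorem pairRotation_injective {c s : ℝ} (h : c ^ 2 + s ^ 2 = 1) :
    Function.Injective (pairRotation (m := m) c s) :=
  Function.LeftInverse.injective (pairRotation_neg_pairRotation h)

/-- Adding `π` to the angle negates cosine and sine, hence negates exactly the paired coordinates;
this compensates for the reflection. -/
theorem pairRotation_neg_neg (c s : ℝ) (y : Fin (m + 1) → ℝ) (j : Fin (m + 1)) :
    pairRotation (-c) (-s) y j =
      if (j : ℕ) < 2 * (m / 2) then -pairRotation c s y j else y j := by
  rw [pairRotation_apply, pairRotation_apply]
  split_ifs <;> ring

/-- The index of the coordinate that is rotated to obtain the `i`-th vector field. -/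
def frameIndex (i : Fin (2 * (m / 2) + 1)) : Fin (m + 1) :=
  if (i : ℕ) < 2 * (m / 2) then ⟨i, by omega⟩ else Fin.last m

theorem frameIndex_injective : Function.Injective (frameIndex (m := m)) := by
  intro i j h
  unfold frameIndex at h
  split_ifs at h <;> simp only [Fin.ext_iff, Fin.val_last] at h ⊢ <;> omega

/-- Vector fields on `ℝⁿ` that descend to a frame, of maximal size, of `Kₙ`. -/
def frame (i : Fin (2 * (m / 2) + 1)) (t : EuclideanSpace ℝ (Fin (m + 1))) :
    EuclideanSpace ℝ (Fin (m + 1)) :=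
  WithLp.toLp 2 (pairRotation (Real.cos (t (Fin.last m))) (Real.sin (t (Fin.last m)))
    (Pi.single (frameIndex i) 1))

theorem contDiff_frame (i : Fin (2 * (m / 2) + 1)) : ContDiff ℝ ∞ (frame i) := by
  rw [contDiff_euclidean]
  intro j
  simp only [frame, pairRotation_apply]
  split_ifs <;> fun_prop

theorem linearIndependent_frame (t : EuclideanSpace ℝ (Fin (m + 1))) :
    LinearIndependent ℝ fun i => frame i t := by
  have h1 : LinearIndependent ℝ
      fun i : Fin (2 * (m / 2) + 1) => (Pi.single (frameIndex i) 1 : Fin (m + 1) → ℝ) := by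
    have h := (Pi.basisFun ℝ (Fin (m + 1))).linearIndependent.comp _ frameIndex_injective
    simpa [Function.comp_def] using h
  have h2 := h1.map' (pairRotation (Real.cos (t (Fin.last m))) (Real.sin (t (Fin.last m))))
    (LinearMap.ker_eq_bot.2 (pairRotation_injective (Real.cos_sq_add_sin_sq _)))
  have h3 := h2.map' (WithLp.linearEquiv 2 ℝ (Fin (m + 1) → ℝ)).symm.toLinearMap
    (LinearEquiv.ker _)
  exact h3

theorem frame_add_const (i : Fin (2 * (m / 2) + 1)) {c : EuclideanSpace ℝ (Fin (m + 1))}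
    (hc : ∀ j, Circle.exp (c j) = 1) (t : EuclideanSpace ℝ (Fin (m + 1))) :
    frame i (t + c) = frame i t := by
  obtain ⟨h1, h2⟩ := cos_sin_of_circleExp_eq_one (hc (Fin.last m))
  simp [frame, Real.cos_add, Real.sin_add, h1, h2]

theorem frame_reflection_add_const (i : Fin (2 * (m / 2) + 1))
    {c : EuclideanSpace ℝ (Fin (m + 1))}
    (hc : ∀ j : Fin (m + 1), Circle.exp (c j) = if (j : ℕ) + 1 = m + 1 then -1 else 1)
    (t : EuclideanSpace ℝ (Fin (m + 1))) :
    frame i (reflection (m + 1) t + c) = reflection (m + 1) (frame i t) := by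
  obtain ⟨h1, h2⟩ := cos_sin_of_circleExp_eq_neg_one (a := c (Fin.last m)) (by simp [hc])
  ext j
  simp only [frame, PiLp.add_apply, reflection_apply, Fin.val_last, if_true, Real.cos_add,
    Real.sin_add, h1, h2, mul_zero, sub_zero, mul_neg, mul_one, add_zero, pairRotation_neg_neg]
  by_cases hj : (j : ℕ) < 2 * (m / 2)
  · rw [if_pos hj, if_neg (by omega)]
  · rw [if_neg hj, pairRotation_apply, if_neg hj]
    by_cases hj' : (j : ℕ) + 1 = m + 1
    · rw [if_pos hj']
    -- Only the unpaired coordinate `m - 1`, for odd `m`, is left. No `frameIndex` takes this value,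
    -- so the component is `0` and its sign is irrelevant.
    · rw [if_neg hj', Pi.single_apply, if_neg, neg_zero]
      rintro rfl
      unfold frameIndex at hj hj'
      split_ifs at hj hj' with h
      · exact hj h
      · simp at hj'

/-- The number `2 * (m / 2) + 1` is `m + 1` for even `m` and `m` for odd `m`. -/
theorem hasIndependentVectorFields (r : ℕ∞) :
    HasIndependentVectorFields r (m + 1) (KleinBottle (m + 1)) (2 * (m / 2) + 1) :=
  hasIndependentVectorFields_of_equivariant r contDiff_frame
    (fun i _ hc => frame_add_const i hc) (fun i _ hc => frame_reflection_add_const i hc)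
    linearIndependent_frame

theorem isManifoldSpan (hn : 1 ≤ n) (r : ℕ∞) :
    (Odd n → IsManifoldSpan r n (KleinBottle n) n) ∧
      (Even n → IsManifoldSpan r n (KleinBottle n) (n - 1)) := by
  obtain ⟨m, rfl⟩ : ∃ m, n = m + 1 := ⟨n - 1, by omega⟩
  have h := hasIndependentVectorFields (m := m) r
  refine ⟨fun ho => ⟨?_, fun k hk => le_of_hasIndependentVectorFields hk⟩,
    fun he => ⟨?_, fun k hk => ?_⟩⟩
  · rw [Nat.odd_iff] at ho
    rwa [show 2 * (m / 2) + 1 = m + 1 by omega] at h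
  · rw [Nat.even_iff] at he
    rwa [show 2 * (m / 2) + 1 = m + 1 - 1 by omega] at h
  · have h1 := le_of_hasIndependentVectorFields hk
    have h2 : k ≠ m + 1 := by
      rintro rfl
      exact not_hasIndependentVectorFields_of_even hn he r hk
    omega

/-! ### The immersion by iterated polar coordinates -/

section LineDerivative

variable {a b : ℝ → ℝ} {a' b' x : ℝ}

/-- The map `(a, b) ↦ (e ^ a cos b, e ^ a sin b)` is an immersion. -/
theorem eq_zero_of_hasDerivAt_polar (ha : HasDerivAt a a' x) (hb : HasDerivAt b b' x)
    (hc : HasDerivAt (fun h => Real.exp (a h) * Real.cos (b h)) 0 x)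
    (hs : HasDerivAt (fun h => Real.exp (a h) * Real.sin (b h)) 0 x) : a' = 0 ∧ b' = 0 := by
  have h1 := hc.unique (ha.exp.mul hb.cos)
  have h2 := hs.unique (ha.exp.mul hb.sin)
  have h3 := Real.cos_sq_add_sin_sq (b x)
  have h4 : Real.exp (a x) ≠ 0 := (Real.exp_pos _).ne'
  constructor
  · refine (mul_eq_zero.1 (?_ : Real.exp (a x) * a' = 0)).resolve_left h4
    linear_combination -Real.cos (b x) * h1 - Real.sin (b x) * h2 - Real.exp (a x) * a' * h3
  · refine (mul_eq_zero.1 (?_ : Real.exp (a x) * b' = 0)).resolve_left h4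
    linear_combination Real.sin (b x) * h1 - Real.cos (b x) * h2 - Real.exp (a x) * b' * h3

/-- The figure eight `b ↦ (sin 2b, sin b)`, rotated by the angle `a`, is an immersion. -/
theorem eq_zero_of_hasDerivAt_figureEight (ha : HasDerivAt a 0 x) (hb : HasDerivAt b b' x)
    (hc : HasDerivAt (fun h => Real.sin (2 * b h) * Real.cos (a h) -
      Real.sin (b h) * Real.sin (a h)) 0 x)
    (hs : HasDerivAt (fun h => Real.sin (2 * b h) * Real.sin (a h) +
      Real.sin (b h) * Real.cos (a h)) 0 x) : b' = 0 := by
  have h1 := hc.unique (((hb.const_mul 2).sin.mul ha.cos).sub (hb.sin.mul ha.sin))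
  have h2 := hs.unique (((hb.const_mul 2).sin.mul ha.sin).add (hb.sin.mul ha.cos))
  have h3 := Real.cos_sq_add_sin_sq (a x)
  have h4 : Real.cos (b x) * b' = 0 := by
    linear_combination Real.sin (a x) * h1 - Real.cos (a x) * h2 - Real.cos (b x) * b' * h3
  have h5 : Real.cos (2 * b x) * (2 * b') = 0 := by
    linear_combination -Real.cos (a x) * h1 - Real.sin (a x) * h2 -
      Real.cos (2 * b x) * (2 * b') * h3
  rw [Real.cos_two_mul] at h5
  -- `cos b` and `cos 2b = 2 cos² b - 1` have no common zero; this combination isolates `b'`.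
  linear_combination 2 * Real.cos (b x) * h4 - h5 / 2

end LineDerivative

/-- The coordinates of a point of `ℝⁿ`, extended by `0`. -/
def coord (t : EuclideanSpace ℝ (Fin (m + 1))) (k : ℕ) : ℝ :=
  if h : k < m + 1 then t ⟨k, h⟩ else 0

theorem coord_val (t : EuclideanSpace ℝ (Fin (m + 1))) (j : Fin (m + 1)) : coord t j = t j :=
  dif_pos j.2

theorem contDiff_coord (k : ℕ) :
    ContDiff ℝ ∞ fun t : EuclideanSpace ℝ (Fin (m + 1)) => coord t k := by
  unfold coord
  split_ifs <;> fun_prop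

theorem coord_add (t c : EuclideanSpace ℝ (Fin (m + 1))) (k : ℕ) :
    coord (t + c) k = coord t k + coord c k := by
  unfold coord
  split_ifs <;> simp

theorem coord_reflection (t : EuclideanSpace ℝ (Fin (m + 1))) (k : ℕ) :
    coord (reflection (m + 1) t) k = if k = m then coord t k else -coord t k := by
  unfold coord
  by_cases h : k < m + 1 <;> simp [h]

/-- The logarithms of the successive radii in the iterated polar coordinates. -/
def logRadius (t : EuclideanSpace ℝ (Fin (m + 1))) : ℕ → ℝ
  | 0 => if Even m then 0 else Real.sin (2 * coord t (m - 1)) * Real.cos (coord t m) -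
      Real.sin (coord t (m - 1)) * Real.sin (coord t m)
  | k + 1 => Real.exp (logRadius t k) * Real.cos (coord t k)

theorem contDiff_logRadius (k : ℕ) :
    ContDiff ℝ ∞ fun t : EuclideanSpace ℝ (Fin (m + 1)) => logRadius t k := by
  have hm := contDiff_coord (m := m) m
  have hm' := contDiff_coord (m := m) (m - 1)
  induction k with
  | zero =>
    unfold logRadius
    split_ifs <;> fun_prop
  | succ k ih =>
    have hk := contDiff_coord (m := m) k
    simp only [logRadius]
    fun_prop

/-- The iterated polar coordinates before the rotation of the pairs of coordinates. -/
def polar (t : EuclideanSpace ℝ (Fin (m + 1))) (j : Fin (m + 1)) : ℝ :=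
  if (j : ℕ) = m then Real.exp (logRadius t (2 * (m / 2))) * Real.sin (2 * coord t m)
  else if (j : ℕ) < 2 * (m / 2) then Real.exp (logRadius t j) * Real.sin (coord t j)
  else Real.sin (2 * coord t (m - 1)) * Real.sin (coord t m) +
    Real.sin (coord t (m - 1)) * Real.cos (coord t m)

theorem contDiff_polar (j : Fin (m + 1)) :
    ContDiff ℝ ∞ fun t : EuclideanSpace ℝ (Fin (m + 1)) => polar t j := by
  have hm := contDiff_coord (m := m) m
  have hm' := contDiff_coord (m := m) (m - 1)
  have hj := contDiff_coord (m := m) j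
  have h1 := contDiff_logRadius (m := m) j
  have h2 := contDiff_logRadius (m := m) (2 * (m / 2))
  unfold polar
  split_ifs <;> fun_prop

/-- An immersion `ℝⁿ → ℝⁿ⁺¹` that is invariant under the deck transformations of `Kₙ`. -/
def coverImmersion (t : EuclideanSpace ℝ (Fin (m + 1))) : EuclideanSpace ℝ (Fin (m + 1 + 1)) :=
  WithLp.toLp 2 (Fin.snoc (α := fun _ => ℝ)
    (pairRotation (Real.cos (coord t m)) (Real.sin (coord t m)) (polar t))
    (Real.exp (logRadius t (2 * (m / 2))) * Real.cos (2 * coord t m)))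

theorem coverImmersion_castSucc (t : EuclideanSpace ℝ (Fin (m + 1))) (j : Fin (m + 1)) :
    coverImmersion t j.castSucc =
      pairRotation (Real.cos (coord t m)) (Real.sin (coord t m)) (polar t) j := by
  simp [coverImmersion]

theorem coverImmersion_last (t : EuclideanSpace ℝ (Fin (m + 1))) :
    coverImmersion t (Fin.last (m + 1)) =
      Real.exp (logRadius t (2 * (m / 2))) * Real.cos (2 * coord t m) := by
  simp [coverImmersion]

theorem contDiff_coverImmersion : ContDiff ℝ ∞ (coverImmersion (m := m)) := by
  rw [contDiff_euclidean]
  have hm := contDiff_coord (m := m) m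
  intro i
  refine Fin.lastCases ?_ (fun j => ?_) i
  · have h2 := contDiff_logRadius (m := m) (2 * (m / 2))
    simp only [coverImmersion_last]
    fun_prop
  · have h1 := contDiff_polar j
    have h2 := contDiff_polar (pairSwap j)
    simp only [coverImmersion_castSucc, pairRotation_apply]
    split_ifs <;> fun_prop

theorem coverImmersion_add_const {c : EuclideanSpace ℝ (Fin (m + 1))}
    (hc : ∀ j, Circle.exp (c j) = 1) (t : EuclideanSpace ℝ (Fin (m + 1))) :
    coverImmersion (t + c) = coverImmersion t := by
  have hk : ∀ k, Real.cos (coord (t + c) k) = Real.cos (coord t k) ∧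
      Real.sin (coord (t + c) k) = Real.sin (coord t k) := by
    intro k
    have h : Real.cos (coord c k) = 1 ∧ Real.sin (coord c k) = 0 := by
      unfold coord
      split_ifs with h
      · exact cos_sin_of_circleExp_eq_one (hc _)
      · simp
    simp [coord_add, Real.cos_add, Real.sin_add, h.1, h.2]
  have hr : ∀ k, logRadius (t + c) k = logRadius t k := by
    intro k
    induction k with
    | zero => simp only [logRadius, Real.sin_two_mul, hk]
    | succ k ih => simp only [logRadius, ih, hk]
  have hp : polar (t + c) = polar t := by
    ext j
    simp only [polar, Real.sin_two_mul, hk, hr]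
  simp only [coverImmersion, Real.cos_two_mul, hk, hr, hp]

/-- The deck transformation negates `sin t_k` for `k < m` and both `cos` and `sin` of `t_m`. The
radii are unchanged; in the paired coordinates the sign of `polar` cancels that of the rotation, and
in the remaining ones every product has two sign changes or involves only the angle `2 t_m`. -/
theorem coverImmersion_reflection_add_const {c : EuclideanSpace ℝ (Fin (m + 1))}
    (hc : ∀ j : Fin (m + 1), Circle.exp (c j) = if (j : ℕ) + 1 = m + 1 then -1 else 1)
    (t : EuclideanSpace ℝ (Fin (m + 1))) :
    coverImmersion (reflection (m + 1) t + c) = coverImmersion t := by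
  set t' := reflection (m + 1) t + c with ht'
  have hm : Real.cos (coord t' m) = -Real.cos (coord t m) ∧
      Real.sin (coord t' m) = -Real.sin (coord t m) := by
    have h : Real.cos (coord c m) = -1 ∧ Real.sin (coord c m) = 0 := by
      have := cos_sin_of_circleExp_eq_neg_one (a := c (Fin.last m)) (by simp [hc])
      rw [coord, dif_pos m.lt_add_one]
      exact this
    simp [ht', coord_add, coord_reflection, Real.cos_add, Real.sin_add, h.1, h.2]
  have hk : ∀ k ≠ m, Real.cos (coord t' k) = Real.cos (coord t k) ∧
      Real.sin (coord t' k) = -Real.sin (coord t k) := by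
    intro k hk
    have h : Real.cos (coord c k) = 1 ∧ Real.sin (coord c k) = 0 := by
      unfold coord
      split_ifs with h
      · exact cos_sin_of_circleExp_eq_one (by rw [hc, if_neg]; simpa using hk)
      · simp
    simp [ht', coord_add, coord_reflection, Real.cos_add, Real.sin_add, h.1, h.2, hk]
  have hr : ∀ k ≤ m, logRadius t' k = logRadius t k := by
    intro k
    induction k with
    | zero =>
      intro _
      by_cases h : Even m
      · simp [logRadius, h]
      · have h1 : m - 1 ≠ m := by
          rintro h1
          exact h (by simp [show m = 0 by omega])
        simp only [logRadius, if_neg h, Real.sin_two_mul, hk _ h1, hm]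
        ring
    | succ k ih =>
      intro h
      simp only [logRadius, ih (by omega), hk k (by omega)]
  have hp : ∀ j, polar t' j = if (j : ℕ) < 2 * (m / 2) then -polar t j else polar t j := by
    intro j
    unfold polar
    by_cases h1 : (j : ℕ) = m
    · rw [if_pos h1, if_pos h1, if_neg (by omega), hr _ (by omega)]
      simp only [Real.sin_two_mul, hm]
      ring
    · rw [if_neg h1, if_neg h1]
      by_cases h2 : (j : ℕ) < 2 * (m / 2)
      · rw [if_pos h2, if_pos h2, if_pos h2, hr _ (by omega), (hk _ h1).2]
        ring
      · rw [if_neg h2, if_neg h2, if_neg h2]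
        simp only [Real.sin_two_mul, hm, hk (m - 1) (by omega)]
        ring
  ext i
  refine Fin.lastCases ?_ (fun j => ?_) i
  · rw [coverImmersion_last, coverImmersion_last, hr _ (by omega), Real.cos_two_mul,
      Real.cos_two_mul, hm.1, neg_sq]
  · rw [coverImmersion_castSucc, coverImmersion_castSucc, hm.1, hm.2, pairRotation_neg_neg,
      pairRotation_apply, pairRotation_apply]
    simp only [hp, pairSwap_lt_iff]
    split_ifs <;> ring

theorem coverImmersion_eq_of_cover_eq {x y : EuclideanSpace ℝ (Fin (m + 1))}
    (h : cover x = cover y) : coverImmersion x = coverImmersion y := by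
  rcases exists_deck_of_cover_eq h with ⟨c, hc, rfl⟩ | ⟨c, hc, rfl⟩
  · exact (coverImmersion_add_const hc x).symm
  · exact (coverImmersion_reflection_add_const hc x).symm

/-- Along the line through `t` in direction `v` all components have derivative `0`; the coordinates
of `v` are shown to vanish one after another, the last coordinate first. -/
theorem eq_zero_of_fderiv_coverImmersion {t v : EuclideanSpace ℝ (Fin (m + 1))}
    (h : fderiv ℝ coverImmersion t v = 0) : v = 0 := by
  let l : ℝ → EuclideanSpace ℝ (Fin (m + 1)) := fun a => t + a • v
  have hl : HasDerivAt l v 0 := by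
    simpa [l] using ((hasDerivAt_id (0 : ℝ)).smul_const v).const_add t
  have hl0 : l 0 = t := by simp [l]
  have hF : HasDerivAt (fun a => coverImmersion (l a)) 0 0 := by
    have h1 : HasFDerivAt coverImmersion (fderiv ℝ coverImmersion t) (l 0) := by
      rw [hl0]
      exact (contDiff_coverImmersion.differentiable (by simp) t).hasFDerivAt
    rw [← h]
    exact h1.comp_hasDerivAt 0 hl
  have hFi : ∀ i, HasDerivAt (fun a => coverImmersion (l a) i) 0 0 := fun i =>
    ((EuclideanSpace.proj (𝕜 := ℝ) i).hasFDerivAt.comp_hasDerivAt 0 hF).congr_deriv (by simp)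
  have hcoord : ∀ k, HasDerivAt (fun a => coord (l a) k) (coord v k) 0 := by
    intro k
    have h1 : (fun a => coord (l a) k) = fun a => coord t k + a * coord v k := by
      funext a
      simp only [l, coord_add]
      unfold coord
      split_ifs <;> simp
    rw [h1]
    simpa using ((hasDerivAt_id (0 : ℝ)).mul_const (coord v k)).const_add (coord t k)
  have hrad : ∀ k, ∃ d, HasDerivAt (fun a => logRadius (l a) k) d 0 := fun k =>
    ⟨_, (((contDiff_logRadius k).differentiable (by simp) (l 0)).hasFDerivAt).comp_hasDerivAt 0 hl⟩
  have hlast : ¬ ((Fin.last m : Fin (m + 1)) : ℕ) < 2 * (m / 2) := by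
    rw [Fin.val_last]
    omega
  obtain ⟨d, hd⟩ := hrad (2 * (m / 2))
  -- Component `m` and the final component are polar coordinates with angle `2 t_m`.
  obtain ⟨rfl, hm2⟩ := eq_zero_of_hasDerivAt_polar hd ((hcoord m).const_mul 2)
    (by simpa only [coverImmersion_last] using hFi (Fin.last (m + 1)))
    (by
      have h1 := hFi (Fin.last m).castSucc
      simp only [coverImmersion_castSucc, pairRotation_apply, if_neg hlast] at h1
      simpa only [polar, Fin.val_last, if_true] using h1)
  have hm : coord v m = 0 := by linarith
  have hs : HasDerivAt (fun a => coord (l a) m) 0 0 := hm ▸ hcoord m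
  have hpolar : ∀ j, HasDerivAt (fun a => polar (l a) j) 0 0 := by
    intro j
    -- The rotation is undone; its coefficients have derivative `0` because `t_m` does.
    have h1 : (fun a => polar (l a) j) = fun a => pairRotation (Real.cos (coord (l a) m))
        (-Real.sin (coord (l a) m)) (fun j => coverImmersion (l a) j.castSucc) j := by
      funext a
      simp only [coverImmersion_castSucc]
      rw [pairRotation_neg_pairRotation (Real.cos_sq_add_sin_sq _)]
    rw [h1]
    simp only [pairRotation_apply]
    have h2 := hFi j.castSucc
    have h3 := hFi (pairSwap j).castSucc
    split_ifs
    · exact ((hs.cos.mul h2).add (hs.sin.neg.neg.mul h3)).congr_deriv (by simp)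
    · exact ((hs.cos.mul h2).add (hs.sin.neg.mul h3)).congr_deriv (by simp)
    · exact h2
  -- The next radius is `e^{ρ_k} cos t_k` and the `k`-th polar coordinate is `e^{ρ_k} sin t_k`, so
  -- `ρ_k` and `t_k` are both stationary.
  have hstep : ∀ k < 2 * (m / 2), HasDerivAt (fun a => logRadius (l a) (k + 1)) 0 0 →
      HasDerivAt (fun a => logRadius (l a) k) 0 0 ∧ coord v k = 0 := by
    intro k hk hk1
    obtain ⟨d, hd⟩ := hrad k
    obtain ⟨rfl, hv⟩ := eq_zero_of_hasDerivAt_polar hd (hcoord k) hk1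
      (by simpa only [polar, if_neg (show k ≠ m by omega), if_pos hk] using
        hpolar ⟨k, by omega⟩)
    exact ⟨hd, hv⟩
  have hall : ∀ k ≤ 2 * (m / 2), HasDerivAt (fun a => logRadius (l a) k) 0 0 := by
    intro k hk
    induction hk using Nat.decreasingInduction with
    | self => exact hd
    | of_succ k hk ih => exact (hstep k hk ih).1
  ext j
  rw [← coord_val]
  simp only [PiLp.zero_apply]
  by_cases h1 : (j : ℕ) < 2 * (m / 2)
  · exact (hstep j h1 (hall _ h1)).2
  by_cases h2 : (j : ℕ) = m
  · rw [h2, hm]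
  -- The unpaired coordinate, present only for odd `m`: `ρ_0` and `polar` at `m - 1` are the two
  -- components of the rotated figure eight.
  have h3 : (j : ℕ) = m - 1 := by omega
  have h4 : ¬ Even m := by
    rw [Nat.even_iff]
    omega
  rw [h3]
  refine eq_zero_of_hasDerivAt_figureEight hs (hcoord (m - 1)) ?_ ?_
  · simpa only [logRadius, if_neg h4] using hall 0 (Nat.zero_le _)
  · simpa only [polar, if_neg h1, if_neg h2] using hpolar j

/-- `coverImmersion` is constant on the fibres of `cover`, so it descends, and in each chart the
descended map is `coverImmersion` itself. The complement is `ℝ` because the codimension is one. -/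
theorem exists_isImmersion (hn : 1 ≤ n) :
    ∃ f : KleinBottle n → EuclideanSpace ℝ (Fin (n + 1)),
      Manifold.IsImmersion (𝓡 n) (𝓡 (n + 1)) ∞ f := by
  obtain ⟨m, rfl⟩ : ∃ m, n = m + 1 := ⟨n - 1, by omega⟩
  let f : KleinBottle (m + 1) → EuclideanSpace ℝ (Fin (m + 1 + 1)) :=
    fun x => coverImmersion (Function.surjInv surjective_cover x)
  have hf : ∀ t, f (cover t) = coverImmersion t := fun t =>
    coverImmersion_eq_of_cover_eq (Function.surjInv_eq surjective_cover _)
  refine ⟨f, Manifold.IsImmersionOfComplement.isImmersion (F := ℝ) fun x => ?_⟩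
  refine Manifold.IsImmersionAtOfComplement.of_injective_fderiv (by simp)
    (chart_mem_atlas (EuclideanSpace ℝ (Fin (m + 1))) x) (mem_chart_source _ x)
    contDiff_coverImmersion (fun t => ?_) ?_ ℝ (by simp)
  · rw [symm_of_mem_atlas (chart_mem_atlas _ x), hf]
  · exact (injective_iff_map_eq_zero _).2 fun v => eq_zero_of_fderiv_coverImmersion

end KleinBottle

end

theorem mainTheorem7 (n : ℕ) (hn : 1 ≤ n) :
    (∀ r : ℕ∞,
      (Odd n → IsManifoldSpan r n (KleinBottle n) n) ∧
      (Even n → IsManifoldSpan r n (KleinBottle n) (n - 1))) ∧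
    ∃ f : KleinBottle n → EuclideanSpace ℝ (Fin (n + 1)),
      Manifold.IsImmersion (𝓡 n) (𝓡 (n + 1)) ∞ f :=
  ⟨KleinBottle.isManifoldSpan hn, KleinBottle.exists_isImmersion hn⟩
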